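/- For a finite simple graph $G$ with vertex set $V$, let $\mathrm{End}^+(G)$ be the universal unital $C^*$-algebra generated by elements $p_{ab}$ ($a,b\in V$) subject to the relations $p_{ab}^*=p_{ab}^2=p_{ab}$ for all $a,b\in V$, $\sum_{b\in V}p_{ab}=1$ for all $a\in V$, and $p_{ab}p_{a'b'}=0$ whenever $a\sim a'$ and $b\not\sim b'$. Let $\mathrm{end}(G)$ be the finite set of graph endomorphisms of $G$. Say that $G$ has only classical endomorphisms if the canonical $*$-homomorphism $\mathrm{End}^+(G)\to C(\mathrm{end}(G))$, $p_{ab}\mapsto\bigl(f\mapsto\delta_{f(a),b}\bigr)$, is an isomorphism. Then the following hold. (i) For every integer $n\ge 0$, the odd cycle $C_{2n+1}$ (where $C_1$ is the graph with one vertex and no edge) has only classical endomorphisms; in particular $\mathrm{End}^+(C_{2n+1})$ is commutative. (ii) For every integer $n\ge 1$, the odd graph $O_n=K(2n-1,n-1)$, whose vertices are the $(n-1)$-element subsets of a $(2n-1)$-element set, two distinct ones being adjacent if and only if they are disjoint, has only classical endomorphisms; in particular $\mathrm{End}^+(O_n)$ is commutative. -/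

import Mathlib

open scoped ENNReal

noncomputable section

/-- The defining relations of `End⁺(G)`, for a family `p a b` in a unital C⋆-algebra `B`:
every `p a b` is a projection, `∑ b, p a b = 1` for every vertex `a`, and
`p a b * p a' b' = 0` whenever `a ∼ a'` and `b ≁ b'`. -/
structure IsQuantumEndomorphism {V : Type} [Fintype V] (G : SimpleGraph V)
    {B : Type*} [CStarAlgebra B] (p : V → V → B) : Prop where
  star_eq : ∀ a b, star (p a b) = p a b
  mul_self : ∀ a b, p a b * p a b = p a b
  sum_eq_one : ∀ a, ∑ b, p a b = 1
  mul_eq_zero : ∀ a a' b b', G.Adj a a' → ¬ G.Adj b b' → p a b * p a' b' = 0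

/-- A model of the relations: a non-zero unital C⋆-algebra together with a family in it that
satisfies the relations. -/
structure QuantumEndModel {V : Type} [Fintype V] (G : SimpleGraph V) : Type 1 where
  carrier : Type
  [cstar : CStarAlgebra carrier]
  [nontrivial : Nontrivial carrier]
  p : V → V → carrier
  isQuantumEndomorphism : IsQuantumEndomorphism G p

namespace QuantumEndModel

variable {V : Type} [Fintype V] {G : SimpleGraph V}

instance (M : QuantumEndModel G) : CStarAlgebra M.carrier := M.cstar

instance (M : QuantumEndModel G) : Nontrivial M.carrier := M.nontrivial

end QuantumEndModel

section Universal

variable {V : Type} [Fintype V] (G : SimpleGraph V)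

/-- The `ℓ^∞`-product of all models. -/
abbrev QuantumEndProduct : Type 1 := lp (fun M : QuantumEndModel G => M.carrier) ∞

instance : CStarAlgebra (QuantumEndProduct G) where

variable {G} in
theorem IsQuantumEndomorphism.norm_le_one {B : Type*} [CStarAlgebra B] {p : V → V → B}
    (hp : IsQuantumEndomorphism G p) (a b : V) : ‖p a b‖ ≤ 1 := by
  have h : ‖p a b‖ = ‖p a b‖ * ‖p a b‖ := by
    rw [← CStarRing.norm_star_mul_self, hp.star_eq, hp.mul_self]
  nlinarith [norm_nonneg (p a b)]

/-- The tuple `(p_M a b)_M` of the `(a, b)` generators of all models `M`. -/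
def quantumEndTuple (a b : V) : QuantumEndProduct G :=
  ⟨fun M => M.p a b, memℓp_infty ⟨1, by
    rintro _ ⟨M, rfl⟩
    exact M.isQuantumEndomorphism.norm_le_one a b⟩⟩

/-- The closed ⋆-subalgebra generated by the tuples `quantumEndTuple G a b`. -/
def quantumEndSubalgebra : StarSubalgebra ℂ (QuantumEndProduct G) :=
  (StarAlgebra.adjoin ℂ {x | ∃ a b, x = quantumEndTuple G a b}).topologicalClosure

instance : IsClosed (quantumEndSubalgebra G : Set (QuantumEndProduct G)) :=
  StarSubalgebra.isClosed_topologicalClosure _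

/-- `End⁺(G) = C(end⁺(G))`, the universal unital C⋆-algebra generated by `p a b`, for vertices
`a, b`, subject to the relations `IsQuantumEndomorphism`.  It is realised as the closed
⋆-subalgebra generated by the `p a b` in the `ℓ^∞`-product of all models, so that the norm of a
⋆-polynomial in the generators is the supremum of its norms over all models; the universal property
is `QuantumEnd.existsUnique_lift`. -/
def QuantumEnd : Type 1 := quantumEndSubalgebra G

namespace QuantumEnd

instance : CStarAlgebra (QuantumEnd G) :=
  inferInstanceAs (CStarAlgebra (quantumEndSubalgebra G))

/-- The generators `p a b` of `End⁺(G)`. -/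
def gen (a b : V) : QuantumEnd G :=
  ⟨quantumEndTuple G a b,
    StarSubalgebra.le_topologicalClosure _ (StarAlgebra.subset_adjoin ℂ _ ⟨a, b, rfl⟩)⟩

variable {G}

/-- The ⋆-homomorphism from `End⁺(G)` to a model, `p a b ↦ p_M a b`. -/
def eval (M : QuantumEndModel G) : QuantumEnd G →⋆ₐ[ℂ] M.carrier where
  toFun x := x.1 M
  map_one' := rfl
  map_mul' _ _ := rfl
  map_zero' := rfl
  map_add' _ _ := rfl
  commutes' _ := rfl
  map_star' _ := rfl

@[simp]
theorem eval_gen (M : QuantumEndModel G) (a b : V) : eval M (gen G a b) = M.p a b := rfl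

theorem ext_eval {x y : QuantumEnd G} (h : ∀ M : QuantumEndModel G, eval M x = eval M y) :
    x = y :=
  Subtype.ext (lp.ext (funext h))

variable (G) in
theorem isQuantumEndomorphism_gen : IsQuantumEndomorphism G (gen G) where
  star_eq a b := ext_eval fun M => by
    rw [map_star, eval_gen, M.isQuantumEndomorphism.star_eq]
  mul_self a b := ext_eval fun M => by
    rw [map_mul, eval_gen, M.isQuantumEndomorphism.mul_self]
  sum_eq_one a := ext_eval fun M => by
    simp only [map_sum, map_one, eval_gen, M.isQuantumEndomorphism.sum_eq_one]
  mul_eq_zero a a' b b' h h' := ext_eval fun M => by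
    rw [map_mul, map_zero, eval_gen, eval_gen,
      M.isQuantumEndomorphism.mul_eq_zero a a' b b' h h']

/-- The universal property of `End⁺(G)`. -/
theorem existsUnique_lift {B : Type} [CStarAlgebra B] (q : V → V → B)
    (hq : IsQuantumEndomorphism G q) :
    ∃! φ : QuantumEnd G →⋆ₐ[ℂ] B, ∀ a b, φ (gen G a b) = q a b := by
  rcases subsingleton_or_nontrivial B with hB | hB
  · refine ⟨⟨⟨⟨⟨⟨fun _ => 0, Subsingleton.elim _ _⟩, fun _ _ => Subsingleton.elim _ _⟩,
      Subsingleton.elim _ _, fun _ _ => Subsingleton.elim _ _⟩, fun _ => Subsingleton.elim _ _⟩,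
      fun _ => Subsingleton.elim _ _⟩, fun _ _ => Subsingleton.elim _ _, fun φ _ => ?_⟩
    ext x
    exact Subsingleton.elim _ _
  · refine ⟨eval ⟨B, q, hq⟩, fun a b => rfl, fun φ hφ => ?_⟩
    have hc : ∀ ψ : QuantumEnd G →⋆ₐ[ℂ] B, Continuous ψ := fun ψ =>
      AddMonoidHomClass.continuous_of_bound ψ 1 fun x => by
        simpa only [one_mul] using NonUnitalStarAlgHom.norm_apply_le ψ x
    refine StarAlgHom.ext_topologicalClosure (hc _) (hc _) ?_
    refine StarAlgHom.ext_adjoin ?_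
    rintro ⟨_, _⟩ ⟨a, b, rfl⟩
    exact hφ a b

end QuantumEnd

/-! ### Classical endomorphisms -/

/-- The finite set `end(G)` of graph endomorphisms is a discrete space. -/
instance : TopologicalSpace (G →g G) := ⊥

instance : DiscreteTopology (G →g G) := ⟨rfl⟩

instance : Finite (G →g G) := DFunLike.finite _

/-- The function `f ↦ δ_{f(a), b}` on `end(G)`. -/
def classicalEndCoord [DecidableEq V] (a b : V) : C(G →g G, ℂ) :=
  ⟨fun f => if f a = b then 1 else 0, continuous_of_discreteTopology⟩

theorem isQuantumEndomorphism_classicalEndCoord [DecidableEq V] :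
    IsQuantumEndomorphism G (classicalEndCoord G) where
  star_eq a b := by
    ext f
    simp [classicalEndCoord, apply_ite]
  mul_self a b := by
    ext f
    simp [classicalEndCoord]
  sum_eq_one a := by
    ext f
    simp [classicalEndCoord]
  mul_eq_zero a a' b b' h h' := by
    ext f
    have : ¬ (f a = b ∧ f a' = b') := by
      rintro ⟨rfl, rfl⟩
      exact h' (f.map_adj h)
    simp only [classicalEndCoord, ContinuousMap.mul_apply, ContinuousMap.coe_mk,
      ContinuousMap.zero_apply]
    grind

instance : Nontrivial C(G →g G, ℂ) :=
  ⟨0, 1, fun h => zero_ne_one (DFunLike.congr_fun h SimpleGraph.Hom.id)⟩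

/-- The canonical ⋆-homomorphism `End⁺(G) → C(end(G))`, `p a b ↦ (f ↦ δ_{f(a), b})`, which exhibits
`end(G)` as a quantum subspace of `end⁺(G)`. -/
def QuantumEnd.toClassical [DecidableEq V] : QuantumEnd G →⋆ₐ[ℂ] C(G →g G, ℂ) :=
  QuantumEnd.eval ⟨C(G →g G, ℂ), classicalEndCoord G, isQuantumEndomorphism_classicalEndCoord G⟩

/-- `G` has only classical endomorphisms, `end⁺(G) = end(G)`: the canonical ⋆-homomorphism
`End⁺(G) → C(end(G))` is an isomorphism. -/
def HasOnlyClassicalEndomorphisms [DecidableEq V] : Prop :=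
  Function.Bijective (QuantumEnd.toClassical G)

end Universal

/-- The Kneser graph `K(n, k)`: the `k`-subsets of an `n`-set, distinct ones being adjacent iff they
are disjoint (distinctness matters only for `k = 0`). -/
def kneserGraph (n k : ℕ) : SimpleGraph {u : Finset (Fin n) // u.card = k} where
  Adj u v := u ≠ v ∧ Disjoint u.1 v.1
  symm := ⟨fun _ _ h => ⟨h.1.symm, h.2.symm⟩⟩
  loopless := ⟨fun _ h => h.1 rfl⟩

/-- The odd graph `O_n = K(2n - 1, n - 1)`, for `n ≥ 1`. -/
abbrev oddGraph (n : ℕ) := kneserGraph (2 * n - 1) (n - 1)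

end

/-! It suffices that the generators commute. Then `QuantumEnd G` is a commutative C*-algebra, its
characters are the 0-1 solutions of the relations, that is, the endomorphisms of `G`, and Gelfand
duality makes `toClassical` injective; surjectivity holds for every graph.

Two tools give commutation. A nonzero product `p a b * p c d` forces every walk from `a` to `c` to
have a counterpart of the same length from `b` to `d` (`exists_walk`). And `p a b` commutes with `p
c d` as soon as `p a b * p c d * p a b' = 0` for all `b' ≠ b`. Apart from the one-vertex cases,
distinct vertices in both families have at most one common neighbour, so adjacent rows commute
(`commute_of_adj`).

Odd cycles: walking the long way round shows `p a b * p (a + 2) b = 0`, so a path cannot fold back.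
Hence the image of one edge determines everything: each entry is a sum of products of entries from
rows `0` and `1`, which commute.

Odd graphs on `k`-subsets of a `(2k + 1)`-set: lengths of even and odd walks together determine `|a
∩ c|`, so nonzero products preserve intersection sizes (`odd_mul_eq_zero`). Rows with `|a ∩ c| = k -
1` commute by an argument on a hexagon (`odd_commute_of_card_inter_add_one`). Smaller intersections
follow by downward induction, through a count that compares the number of rows with the number of
columns available to them (`eq_zero_of_card_lt`). -/

namespace IsQuantumEndomorphism

/-! ### Consequences of the relations for an arbitrary graph -/

variable {V : Type} [Fintype V] {G : SimpleGraph V} {B : Type*} [CStarAlgebra B] {p : V → V → B}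

/-- Projections with sum `1` are orthogonal: compressing the sum by `p a b'` leaves a vanishing sum
of positive elements `star x * x` with `x = p a c * p a b'`. -/
theorem mul_eq_zero_of_ne (hp : IsQuantumEndomorphism G p) (a : V) {b b' : V} (h : b ≠ b') :
    p a b * p a b' = 0 := by
  classical
  let := CStarAlgebra.spectralOrder B
  have := CStarAlgebra.spectralOrderedRing B
  have h1 : p a b' * (∑ c, p a c) * p a b' = p a b' := by
    rw [hp.sum_eq_one, mul_one, hp.mul_self]
  have h2 : ∑ c ∈ Finset.univ.erase b', star (p a c * p a b') * (p a c * p a b') = 0 := by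
    rw [Finset.mul_sum, Finset.sum_mul, ← Finset.add_sum_erase _ _ (Finset.mem_univ b'),
      hp.mul_self, hp.mul_self, add_eq_left] at h1
    rw [← h1]
    refine Finset.sum_congr rfl fun c _ => ?_
    rw [star_mul, hp.star_eq, hp.star_eq, mul_assoc, ← mul_assoc (p a c), hp.mul_self, mul_assoc]
  have h3 := (Finset.sum_eq_zero_iff_of_nonneg fun c _ => star_mul_self_nonneg _).1 h2 b (by simpa)
  exact (CStarRing.star_mul_self_eq_zero_iff _).1 h3

/-- Inserting `1 = ∑ d, p c d` into a product in which only the term of `d₀` survives. -/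
theorem mul_mul_eq_mul (hp : IsQuantumEndomorphism G p) (c d₀ : V) {x y : B}
    (h : ∀ d, d ≠ d₀ → x * p c d * y = 0) : x * p c d₀ * y = x * y := by
  have h1 : x * (∑ d, p c d) * y = x * y := by rw [hp.sum_eq_one, mul_one]
  rw [← h1, Finset.mul_sum, Finset.sum_mul]
  exact (Finset.sum_eq_single d₀ (fun d _ hd => h d hd) (by simp)).symm

theorem mul_eq_zero_of_forall (hp : IsQuantumEndomorphism G p) (c : V) {x y : B}
    (h : ∀ d, x * p c d * y = 0) : x * y = 0 := by
  have h1 : x * (∑ d, p c d) * y = x * y := by rw [hp.sum_eq_one, mul_one]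
  rw [← h1, Finset.mul_sum, Finset.sum_mul]
  exact Finset.sum_eq_zero fun d _ => h d

theorem mul_eq_zero_comm (hp : IsQuantumEndomorphism G p) {a b c d : V} :
    p a b * p c d = 0 ↔ p c d * p a b = 0 := by
  rw [← star_eq_zero, star_mul, hp.star_eq, hp.star_eq]

/-- Inserting `1 = ∑ x, p v x` at the second vertex `v` of the walk, some term survives; its `x` is
the next vertex of the image walk. -/
theorem exists_walk (hp : IsQuantumEndomorphism G p) {a c : V} (w : G.Walk a c) {b d : V}
    (h : p a b * p c d ≠ 0) : ∃ w' : G.Walk b d, w'.length = w.length := by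
  classical
  induction w generalizing b with
  | nil =>
    obtain rfl : b = d := by
      by_contra hbd
      exact h (hp.mul_eq_zero_of_ne _ hbd)
    exact ⟨.nil, rfl⟩
  | @cons u v w hadj w' ih =>
    obtain ⟨x, hx⟩ : ∃ x, p u b * p v x * p w d ≠ 0 := by
      by_contra! hx
      exact h (hp.mul_eq_zero_of_forall v hx)
    have hbx : G.Adj b x := by
      by_contra hbx
      exact hx (by rw [hp.mul_eq_zero _ _ _ _ hadj hbx, zero_mul])
    obtain ⟨w'', hw''⟩ := ih (b := x) fun h0 => hx (by rw [mul_assoc, h0, mul_zero])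
    exact ⟨.cons hbx w'', by simp [hw'']⟩

/-- The hypothesis gives `p a b * p c d = p a b * p c d * p a b`, whose right side is self-adjoint.
-/
theorem commute_of_mul_mul_eq_zero (hp : IsQuantumEndomorphism G p) {a b c d : V}
    (h : ∀ b', b' ≠ b → p a b * p c d * p a b' = 0) : Commute (p a b) (p c d) := by
  have h1 : p a b * p c d * p a b * 1 = p a b * p c d * 1 :=
    hp.mul_mul_eq_mul a b fun b' hb' => by rw [h b' hb', zero_mul]
  rw [mul_one, mul_one] at h1
  have h2 := congrArg star h1
  simp only [star_mul, hp.star_eq] at h2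
  rw [← mul_assoc, h1] at h2
  exact h2

theorem commute_of_eq (hp : IsQuantumEndomorphism G p) (a b b' : V) :
    Commute (p a b) (p a b') := by
  by_cases h : b = b'
  · rw [h]
  · rw [Commute, SemiconjBy, hp.mul_eq_zero_of_ne a h, hp.mul_eq_zero_of_ne a (Ne.symm h)]

/-- If distinct vertices have at most one common neighbour, then the rows of adjacent vertices
commute. -/
theorem commute_of_adj (hp : IsQuantumEndomorphism G p)
    (hG : ∀ b b' x y, b ≠ b' → G.Adj b x → G.Adj b' x → G.Adj b y → G.Adj b' y → x = y)
    {a c : V} (hac : G.Adj a c) (b d : V) : Commute (p a b) (p c d) := by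
  refine hp.commute_of_mul_mul_eq_zero fun b' hb' => ?_
  by_cases hd : G.Adj b d ∧ G.Adj b' d
  -- As `d` is the only common neighbour of `b` and `b'`, the factor `p c d` can be replaced by the
  -- full sum `1`.
  · rw [hp.mul_mul_eq_mul c d, hp.mul_eq_zero_of_ne _ hb'.symm]
    intro x hx
    by_cases hbx : G.Adj b x
    · rw [mul_assoc, hp.mul_eq_zero c a x b' hac.symm, mul_zero]
      exact fun hb'x => hx (hG b b' x d hb'.symm hbx hb'x.symm hd.1 hd.2)
    · rw [hp.mul_eq_zero a c b x hac hbx, zero_mul]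
  · rw [not_and_or] at hd
    rcases hd with hd | hd
    · rw [hp.mul_eq_zero a c b d hac hd, zero_mul]
    · rw [mul_assoc, hp.mul_eq_zero c a d b' hac.symm (fun h => hd h.symm), mul_zero]

end IsQuantumEndomorphism

/-! ### Commuting generators imply classicality -/

section Classical

variable {V : Type} [Fintype V] {G : SimpleGraph V}

theorem QuantumEnd.mul_comm_of_gen
    (h : ∀ a b c d, Commute (QuantumEnd.gen G a b) (QuantumEnd.gen G c d)) (x y : QuantumEnd G) :
    x * y = y * x := by
  have hcomm : ∀ a b c d, quantumEndTuple G a b * quantumEndTuple G c d =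
      quantumEndTuple G c d * quantumEndTuple G a b := fun a b c d =>
    congrArg Subtype.val (h a b c d).eq
  have hstar : ∀ a b, star (quantumEndTuple G a b) = quantumEndTuple G a b := fun a b =>
    congrArg Subtype.val ((QuantumEnd.isQuantumEndomorphism_gen G).star_eq a b)
  have hadj : IsMulCommutative
      (StarAlgebra.adjoin ℂ {x | ∃ a b, x = quantumEndTuple G a b}) := by
    refine StarAlgebra.isMulCommutative_adjoin ℂ ?_ ?_
    · rintro _ ⟨a, b, rfl⟩ _ ⟨c, d, rfl⟩
      exact hcomm a b c d
    · rintro _ ⟨a, b, rfl⟩ _ ⟨c, d, rfl⟩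
      rw [hstar]
      exact hcomm a b c d
  exact (StarSubalgebra.commRingTopologicalClosure
    (StarAlgebra.adjoin ℂ {x | ∃ a b, x = quantumEndTuple G a b})
    (fun x y => hadj.is_comm.comm x y)).mul_comm x y

variable [DecidableEq V]

theorem QuantumEnd.toClassical_surjective : Function.Surjective (QuantumEnd.toClassical G) := by
  intro g
  let := Fintype.ofFinite (G →g G)
  -- The product over `a` is the indicator function of the point `f`.
  have hg : g = ∑ f : G →g G, g f • ∏ a, classicalEndCoord G a (f a) := by
    ext f₀
    rw [ContinuousMap.sum_apply, Finset.sum_eq_single f₀]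
    · simp [classicalEndCoord]
    · intro f _ hf
      obtain ⟨a, ha⟩ : ∃ a, f₀ a ≠ f a := by
        by_contra! hfa
        exact hf (DFunLike.ext _ _ fun a => (hfa a).symm)
      rw [ContinuousMap.smul_apply, ContinuousMap.prod_apply,
        Finset.prod_eq_zero (Finset.mem_univ a) (by simp [classicalEndCoord, ha]), smul_zero]
    · simp
  have hmem : g ∈ (QuantumEnd.toClassical G).toAlgHom.range := by
    rw [hg]
    refine sum_mem fun f _ => Subalgebra.smul_mem _ (Subalgebra.prod_mem _ fun a _ => ?_) _
    exact ⟨QuantumEnd.gen G a (f a), rfl⟩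
  exact hmem

theorem IsQuantumEndomorphism.exists_hom {q : V → V → ℂ} (hq : IsQuantumEndomorphism G q) :
    ∃ f : G →g G, ∀ a b, q a b = if f a = b then 1 else 0 := by
  have h1 : ∀ a, ∃ b, q a b ≠ 0 := by
    intro a
    by_contra! h
    simpa [h] using hq.sum_eq_one a
  choose f hf using h1
  refine ⟨⟨f, fun {a a'} h => ?_⟩, fun a b => ?_⟩
  · by_contra h'
    exact mul_ne_zero (hf a) (hf a') (hq.mul_eq_zero _ _ _ _ h h')
  · change q a b = if f a = b then 1 else 0
    split_ifs with h
    · subst h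
      exact mul_right_cancel₀ (hf a) ((hq.mul_self a (f a)).trans (one_mul _).symm)
    · exact (_root_.mul_eq_zero.1 (hq.mul_eq_zero_of_ne a h)).resolve_left (hf a)

/-- Every character restricts on the generators to a scalar quantum endomorphism, hence is
evaluation at some `f : G →g G` composed with `toClassical`. So all characters vanish on the kernel.
-/
theorem QuantumEnd.toClassical_injective (hcomm : ∀ x y : QuantumEnd G, x * y = y * x) :
    Function.Injective (QuantumEnd.toClassical G) := by
  rw [injective_iff_map_eq_zero]
  intro x hx
  let : CommCStarAlgebra (QuantumEnd G) :=
    { (inferInstance : CStarAlgebra (QuantumEnd G)) with mul_comm := hcomm }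
  refine (gelfandTransform_isometry (QuantumEnd G)).injective ?_
  rw [map_zero]
  ext χ
  change χ x = 0
  let ψ : QuantumEnd G →⋆ₐ[ℂ] ℂ :=
    { WeakDual.CharacterSpace.toAlgHom χ with map_star' := fun y => map_star χ y }
  have hgen := QuantumEnd.isQuantumEndomorphism_gen G
  have hq : IsQuantumEndomorphism G fun a b => ψ (QuantumEnd.gen G a b) :=
    { star_eq := fun a b => by rw [← map_star, hgen.star_eq]
      mul_self := fun a b => by rw [← map_mul, hgen.mul_self]
      sum_eq_one := fun a => by rw [← map_sum, hgen.sum_eq_one, map_one]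
      mul_eq_zero := fun a a' b b' h h' => by
        rw [← map_mul, hgen.mul_eq_zero a a' b b' h h', map_zero] }
  obtain ⟨f, hf⟩ := hq.exists_hom
  let φ : QuantumEnd G →⋆ₐ[ℂ] ℂ :=
    (ContinuousMap.evalStarAlgHom ℂ ℂ f).comp (QuantumEnd.toClassical G)
  have hφψ : ψ = φ := (QuantumEnd.existsUnique_lift _ hq).unique (fun _ _ => rfl)
    fun a b => (hf a b).symm
  have h0 : ψ x = 0 := by
    rw [hφψ]
    change (QuantumEnd.toClassical G x) f = 0
    rw [hx, ContinuousMap.zero_apply]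
  exact h0

/-- A graph all of whose quantum endomorphisms have commuting entries has only classical
endomorphisms. -/
theorem hasOnlyClassicalEndomorphisms_of_commute
    (h : ∀ a b c d, Commute (QuantumEnd.gen G a b) (QuantumEnd.gen G c d)) :
    HasOnlyClassicalEndomorphisms G ∧ ∀ x y : QuantumEnd G, x * y = y * x :=
  ⟨⟨QuantumEnd.toClassical_injective (QuantumEnd.mul_comm_of_gen h),
    QuantumEnd.toClassical_surjective⟩, QuantumEnd.mul_comm_of_gen h⟩

end Classical

/-! ### Odd cycles, of length `m + 2` with `m` odd -/

section Cycle

open scoped Fin.CommRing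

variable {m : ℕ}

theorem cycleGraph_adj_iff_eq_add {a b : Fin (m + 2)} :
    (SimpleGraph.cycleGraph (m + 2)).Adj a b ↔ b = a + 1 ∨ b = a + -1 := by
  rw [SimpleGraph.cycleGraph_adj, or_comm]
  refine or_congr ⟨fun h => ?_, fun h => ?_⟩ ⟨fun h => ?_, fun h => ?_⟩
  · rw [← h]; ring
  · rw [h]; ring
  · rw [← h]; ring
  · rw [h]; ring

theorem Fin.intCast_eq_zero_iff_dvd (k : ℤ) :
    ((k : ℤ) : Fin (m + 2)) = 0 ↔ ((m + 2 : ℕ) : ℤ) ∣ k :=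
  ZMod.intCast_zmod_eq_zero_iff_dvd k (m + 2)

theorem cycleGraph_exists_walk_add (a : Fin (m + 2)) (k : ℕ) :
    ∃ w : (SimpleGraph.cycleGraph (m + 2)).Walk a (a + (k : Fin (m + 2))), w.length = k := by
  induction k with
  | zero => exact ⟨SimpleGraph.Walk.nil.copy rfl (by simp), by simp⟩
  | succ k ih =>
    obtain ⟨w, hw⟩ := ih
    refine ⟨w.concat (cycleGraph_adj_iff_eq_add.2 (Or.inl ?_)), by simp [hw]⟩
    push_cast
    ring

/-- `s` is the net number of steps in the lift to `ℤ`; for an odd closed walk it is a nonzero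
multiple of `m + 2`. -/
theorem cycleGraph_walk_displacement {a b : Fin (m + 2)}
    (w : (SimpleGraph.cycleGraph (m + 2)).Walk a b) :
    ∃ s : ℤ, |s| ≤ w.length ∧ (2 : ℤ) ∣ w.length - s ∧ b = a + (s : Fin (m + 2)) := by
  induction w with
  | nil => exact ⟨0, by simp, by simp, by simp⟩
  | cons h w ih =>
    obtain ⟨s, hs, hs2, rfl⟩ := ih
    rcases cycleGraph_adj_iff_eq_add.1 h with rfl | rfl
    · refine ⟨s + 1, ?_, ?_, by push_cast; ring⟩ <;> rw [SimpleGraph.Walk.length_cons] <;> grind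
    · refine ⟨s + -1, ?_, ?_, by push_cast; ring⟩ <;> rw [SimpleGraph.Walk.length_cons] <;> grind

theorem cycleGraph_length_le_of_odd_closed {a : Fin (m + 2)}
    (w : (SimpleGraph.cycleGraph (m + 2)).Walk a a) (hw : Odd w.length) : m + 2 ≤ w.length := by
  obtain ⟨s, hs, hs2, h⟩ := cycleGraph_walk_displacement w
  have hdvd := (Fin.intCast_eq_zero_iff_dvd s).1 (left_eq_add.1 h)
  have hs0 : s ≠ 0 := by
    rintro rfl
    obtain ⟨k, hk⟩ := hw
    omega
  have := Int.le_of_dvd (abs_pos.2 hs0) ((dvd_abs _ _).2 hdvd)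
  omega

theorem Fin.two_ne_zero_of_odd (hm : Odd m) : (2 : Fin (m + 2)) ≠ 0 := by
  intro h
  have h' : ((2 : ℤ) : Fin (m + 2)) = 0 := by exact_mod_cast h
  rw [Fin.intCast_eq_zero_iff_dvd] at h'
  have := Int.le_of_dvd (by norm_num) h'
  obtain ⟨k, rfl⟩ := hm
  omega

theorem Fin.four_ne_zero_of_odd (hm : Odd m) : (4 : Fin (m + 2)) ≠ 0 := by
  intro h
  have h' : ((4 : ℤ) : Fin (m + 2)) = 0 := by exact_mod_cast h
  rw [Fin.intCast_eq_zero_iff_dvd] at h'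
  obtain ⟨k, rfl⟩ := hm
  have := Int.le_of_dvd (by norm_num) h'
  obtain rfl : k = 0 := by omega
  norm_num at h'

theorem cycleGraph_eq_of_common_neighbors (hm : Odd m) (b b' x y : Fin (m + 2)) (hb : b ≠ b')
    (hx : (SimpleGraph.cycleGraph (m + 2)).Adj b x) (hx' : (SimpleGraph.cycleGraph (m + 2)).Adj b' x)
    (hy : (SimpleGraph.cycleGraph (m + 2)).Adj b y)
    (hy' : (SimpleGraph.cycleGraph (m + 2)).Adj b' y) : x = y := by
  have h4 := Fin.four_ne_zero_of_odd hm
  rw [cycleGraph_adj_iff_eq_add] at hx hx' hy hy'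
  rcases hx with rfl | rfl <;> rcases hy with rfl | rfl <;> try rfl
  · rcases hx' with h | h
    · exact absurd (add_right_cancel h) hb
    · rcases hy' with h' | h'
      · refine absurd ?_ h4
        linear_combination h - h'
      · exact absurd (add_right_cancel h') hb
  · rcases hx' with h | h
    · rcases hy' with h' | h'
      · exact absurd (add_right_cancel h') hb
      · refine absurd ?_ h4
        linear_combination h' - h
    · exact absurd (add_right_cancel h) hb

variable {B : Type*} [CStarAlgebra B] {p : Fin (m + 2) → Fin (m + 2) → B}

namespace IsQuantumEndomorphism

/-- The walk of length `m` from `a + 2` on round to `a` would be carried to an odd closed walk at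
`b`, shorter than the cycle. -/
theorem cycle_mul_add_two_eq_zero (hm : Odd m)
    (hp : IsQuantumEndomorphism (SimpleGraph.cycleGraph (m + 2)) p) (a b : Fin (m + 2)) :
    p a b * p (a + 2) b = 0 := by
  rw [hp.mul_eq_zero_comm]
  by_contra h
  obtain ⟨w, hw⟩ := cycleGraph_exists_walk_add (a + 2) m
  have hend : a + 2 + (m : Fin (m + 2)) = a := by
    have h0 : ((m + 2 : ℕ) : Fin (m + 2)) = 0 := Fin.natCast_self _
    push_cast at h0
    linear_combination h0
  obtain ⟨w', hw'⟩ := hp.exists_walk (w.copy rfl hend) h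
  rw [SimpleGraph.Walk.length_copy, hw] at hw'
  have := cycleGraph_length_le_of_odd_closed w' (by rw [hw']; exact hm)
  omega

theorem cycle_commute_add_one (hm : Odd m)
    (hp : IsQuantumEndomorphism (SimpleGraph.cycleGraph (m + 2)) p) (a b d : Fin (m + 2)) :
    Commute (p a b) (p (a + 1) d) :=
  hp.commute_of_adj (cycleGraph_eq_of_common_neighbors hm)
    (cycleGraph_adj_iff_eq_add.2 (Or.inl rfl)) b d

/-- Both sides equal the triple product over rows `a`, `a + 1`, `a + 2`: the neighbours of `b + s`
are `b` and `b + s + s`, and folding back is excluded by `cycle_mul_add_two_eq_zero`. -/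
theorem cycle_mul_shift (hm : Odd m)
    (hp : IsQuantumEndomorphism (SimpleGraph.cycleGraph (m + 2)) p) {s : Fin (m + 2)}
    (hs : s = 1 ∨ s = -1) (a b : Fin (m + 2)) :
    p a b * p (a + 1) (b + s) = p (a + 1) (b + s) * p (a + 1 + 1) (b + s + s) := by
  have hadj : (SimpleGraph.cycleGraph (m + 2)).Adj (a + 1) a :=
    cycleGraph_adj_iff_eq_add.2 (Or.inr (by ring))
  have hadj' : (SimpleGraph.cycleGraph (m + 2)).Adj (a + 1) (a + 1 + 1) :=
    cycleGraph_adj_iff_eq_add.2 (Or.inl rfl)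
  have hcol : ∀ x, p a x * p (a + 1 + 1) x = 0 := fun x => by
    rw [add_assoc, one_add_one_eq_two]
    exact hp.cycle_mul_add_two_eq_zero hm a x
  have hnbr : ∀ x, (SimpleGraph.cycleGraph (m + 2)).Adj (b + s) x → x = b ∨ x = b + s + s := by
    intro x hx
    rcases cycleGraph_adj_iff_eq_add.1 hx with rfl | rfl <;> rcases hs with rfl | rfl
    · exact Or.inr rfl
    · exact Or.inl (by ring)
    · exact Or.inl (by ring)
    · exact Or.inr rfl
  have hc := hp.cycle_commute_add_one hm a b (b + s)
  have h1 := hp.mul_mul_eq_mul (a + 1 + 1) (b + s + s) (x := p a b * p (a + 1) (b + s)) (y := 1) ?_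
  have h2 := hp.mul_mul_eq_mul a b (x := 1) (y := p (a + 1) (b + s) * p (a + 1 + 1) (b + s + s)) ?_
  · simp only [one_mul, mul_one] at h1 h2
    rw [← h1, ← h2, mul_assoc]
  · intro x hx
    rw [one_mul, ← mul_assoc]
    by_cases hxa : (SimpleGraph.cycleGraph (m + 2)).Adj (b + s) x
    · obtain rfl := (hnbr x hxa).resolve_left hx
      rw [(hp.cycle_commute_add_one hm a (b + s + s) (b + s)).eq, mul_assoc, hcol, mul_zero]
    · rw [hp.mul_eq_zero_comm.1 (hp.mul_eq_zero _ _ _ _ hadj hxa), zero_mul]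
  · intro x hx
    rw [mul_one]
    by_cases hxa : (SimpleGraph.cycleGraph (m + 2)).Adj (b + s) x
    · obtain rfl := (hnbr x hxa).resolve_right hx
      rw [hc.eq, mul_assoc, hcol, mul_zero]
    · rw [mul_assoc, hp.mul_eq_zero _ _ _ _ hadj' hxa, mul_zero]

theorem cycle_mul_eq_mul_zero (hm : Odd m)
    (hp : IsQuantumEndomorphism (SimpleGraph.cycleGraph (m + 2)) p) {s : Fin (m + 2)}
    (hs : s = 1 ∨ s = -1) (k : ℕ) (b : Fin (m + 2)) :
    p k (b + k * s) * p (k + 1) (b + k * s + s) = p 0 b * p (0 + 1) (b + s) := by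
  induction k with
  | zero => simp
  | succ k ih =>
    rw [← ih, hp.cycle_mul_shift hm hs (k : Fin (m + 2))]
    push_cast
    congr 2 <;> ring

theorem cycle_eq_add (hm : Odd m)
    (hp : IsQuantumEndomorphism (SimpleGraph.cycleGraph (m + 2)) p) (a x : Fin (m + 2)) :
    ∃ b b', p a x = p 0 b * p (0 + 1) (b + 1) + p 0 b' * p (0 + 1) (b' + -1) := by
  have hsum : p a x = p a x * p (a + 1) (x + 1) + p a x * p (a + 1) (x + -1) := by
    have hne : x + 1 ≠ x + -1 := fun h => Fin.two_ne_zero_of_odd hm (by linear_combination h)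
    conv_lhs => rw [← mul_one (p a x), ← hp.sum_eq_one (a + 1), Finset.mul_sum]
    rw [← Finset.sum_pair (f := fun y => p a x * p (a + 1) y) hne]
    refine (Finset.sum_subset (Finset.subset_univ _) fun y _ hy => ?_).symm
    refine hp.mul_eq_zero _ _ _ _ (cycleGraph_adj_iff_eq_add.2 (Or.inl rfl)) fun h => hy ?_
    simpa using cycleGraph_adj_iff_eq_add.1 h
  -- Sliding the edge from `a` to `a + 1` back to the edge from `0` to `1` moves the image of its
  -- first vertex from `x` to `x - a * s`.
  refine ⟨x - a * 1, x - a * -1, hsum.trans ?_⟩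
  have key : ∀ s : Fin (m + 2), s = 1 ∨ s = -1 →
      p a x * p (a + 1) (x + s) = p 0 (x - a * s) * p (0 + 1) (x - a * s + s) := by
    intro s hs
    have h := hp.cycle_mul_eq_mul_zero hm hs a.val (x - a * s)
    rw [Fin.cast_val_eq_self, sub_add_cancel] at h
    exact h
  rw [key 1 (Or.inl rfl), key (-1) (Or.inr rfl)]

theorem cycle_commute (hm : Odd m)
    (hp : IsQuantumEndomorphism (SimpleGraph.cycleGraph (m + 2)) p) (a b c d : Fin (m + 2)) :
    Commute (p a b) (p c d) := by
  have key : ∀ b y b' y', Commute (p 0 b * p (0 + 1) y) (p 0 b' * p (0 + 1) y') := by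
    intro b y b' y'
    exact ((hp.commute_of_eq _ _ _).mul_right (hp.cycle_commute_add_one hm _ _ _)).mul_left
      ((hp.cycle_commute_add_one hm _ _ _).symm.mul_right (hp.commute_of_eq _ _ _))
  obtain ⟨x, x', hx⟩ := hp.cycle_eq_add hm a b
  obtain ⟨y, y', hy⟩ := hp.cycle_eq_add hm c d
  rw [hx, hy]
  exact ((key _ _ _ _).add_right (key _ _ _ _)).add_left
    ((key _ _ _ _).add_right (key _ _ _ _))

end IsQuantumEndomorphism

end Cycle

theorem hasOnlyClassicalEndomorphisms_cycleGraph (n : ℕ) :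
    HasOnlyClassicalEndomorphisms (SimpleGraph.cycleGraph (2 * n + 1)) ∧
      ∀ x y : QuantumEnd (SimpleGraph.cycleGraph (2 * n + 1)), x * y = y * x := by
  refine hasOnlyClassicalEndomorphisms_of_commute ?_
  rcases n with _ | n
  · intro a b c d
    obtain rfl : a = c := Subsingleton.elim (α := Fin 1) a c
    exact (QuantumEnd.isQuantumEndomorphism_gen _).commute_of_eq _ _ _
  · exact (QuantumEnd.isQuantumEndomorphism_gen
      (SimpleGraph.cycleGraph ((2 * n + 1) + 2))).cycle_commute ⟨n, rfl⟩

/-! ### Combinatorics of the odd graph: walks, exchanges, hexagons -/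

section Kneser

variable {N k : ℕ}

theorem kneserGraph_adj_iff_disjoint (hk : 1 ≤ k) {u v : {u : Finset (Fin N) // u.card = k}} :
    (kneserGraph N k).Adj u v ↔ Disjoint u.1 v.1 := by
  refine ⟨fun h => h.2, fun h => ⟨?_, h⟩⟩
  rintro rfl
  have := Finset.card_eq_zero.2 (disjoint_self.1 h)
  have := u.2
  omega

theorem card_inter_ne_of_ne {u v : {u : Finset (Fin N) // u.card = k}} (h : u ≠ v) :
    (u.1 ∩ v.1).card ≠ k := by
  intro h'
  have h1 := Finset.eq_of_subset_of_card_le (Finset.inter_subset_left (s₁ := u.1) (s₂ := v.1))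
    (by rw [h', u.2])
  have h2 := Finset.eq_of_subset_of_card_le (Finset.inter_subset_right (s₁ := u.1) (s₂ := v.1))
    (by rw [h', v.2])
  exact h (Subtype.ext (h1.symm.trans h2))

theorem card_union_add_card_inter_eq (u v : {u : Finset (Fin N) // u.card = k}) :
    (u.1 ∪ v.1).card + (u.1 ∩ v.1).card = 2 * k := by
  rw [Finset.card_union_add_card_inter, u.2, v.2, two_mul]

theorem card_sdiff_add_card_inter_eq (u : {u : Finset (Fin N) // u.card = k})
    (v : Finset (Fin N)) : (u.1 \ v).card + (u.1 ∩ v).card = k := by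
  rw [Finset.card_sdiff_add_card_inter, u.2]

/-- In the odd graph a common neighbour of two distinct vertices is the complement of their
union. -/
theorem eq_compl_union_of_disjoint (hN : N = 2 * k + 1)
    {u v x : {u : Finset (Fin N) // u.card = k}} (huv : u ≠ v) (hux : Disjoint u.1 x.1)
    (hvx : Disjoint v.1 x.1) : x.1 = (u.1 ∪ v.1)ᶜ ∧ (u.1 ∩ v.1).card + 1 = k := by
  have h1 := card_inter_ne_of_ne huv
  have h2 := card_union_add_card_inter_eq u v
  have h3 := card_sdiff_add_card_inter_eq u v.1
  have h4 : (u.1 ∪ v.1)ᶜ.card = N - (u.1 ∪ v.1).card := by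
    rw [Finset.card_compl, Fintype.card_fin]
  have hsub : x.1 ⊆ (u.1 ∪ v.1)ᶜ := by
    intro i hi
    rw [Finset.mem_compl, Finset.mem_union, not_or]
    exact ⟨fun h => Finset.disjoint_left.1 hux h hi, fun h => Finset.disjoint_left.1 hvx h hi⟩
  have h5 := Finset.card_le_card hsub
  rw [x.2] at h5
  exact ⟨Finset.eq_of_subset_of_card_le hsub (by rw [x.2]; omega), by omega⟩

theorem eq_of_common_neighbors (hN : N = 2 * k + 1)
    {u v x y : {u : Finset (Fin N) // u.card = k}} (huv : u ≠ v) (hux : Disjoint u.1 x.1)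
    (hvx : Disjoint v.1 x.1) (huy : Disjoint u.1 y.1) (hvy : Disjoint v.1 y.1) : x = y :=
  Subtype.ext ((eq_compl_union_of_disjoint hN huv hux hvx).1.trans
    (eq_compl_union_of_disjoint hN huv huy hvy).1.symm)

theorem exists_common_neighbor (hN : N = 2 * k + 1)
    {u v : {u : Finset (Fin N) // u.card = k}} (h : (u.1 ∩ v.1).card + 1 = k) :
    ∃ x : {u : Finset (Fin N) // u.card = k}, Disjoint u.1 x.1 ∧ Disjoint v.1 x.1 := by
  refine ⟨⟨(u.1 ∪ v.1)ᶜ, ?_⟩, ?_, ?_⟩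
  · have := card_union_add_card_inter_eq u v
    rw [Finset.card_compl, Fintype.card_fin]
    omega
  · exact disjoint_compl_right.mono_left Finset.subset_union_left
  · exact disjoint_compl_right.mono_left Finset.subset_union_right

theorem card_sdiff_comm_of_card (u v : {u : Finset (Fin N) // u.card = k}) :
    (u.1 \ v.1).card = (v.1 \ u.1).card :=
  Finset.card_sdiff_comm (u.2.trans v.2.symm)

/-- Adjacent `b` and `x` are disjoint and cover all but one point. So prepending an edge turns a
bound on a difference into the same bound on an intersection, and a bound on an intersection into
one on a difference, one larger. -/
theorem oddGraph_card_le_of_walk (hN : N = 2 * k + 1)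
    {b d : {u : Finset (Fin N) // u.card = k}} (w : (kneserGraph N k).Walk b d) (j : ℕ) :
    (w.length = 2 * j → (b.1 \ d.1).card ≤ j) ∧ (w.length = 2 * j + 1 → (b.1 ∩ d.1).card ≤ j) := by
  induction w generalizing j with
  | nil => simp
  | @cons b x d h w ih =>
    rw [SimpleGraph.Walk.length_cons]
    refine ⟨fun hj => ?_, fun hj => ?_⟩
    · have h1 := (ih (j - 1)).2 (by omega)
      rw [card_sdiff_comm_of_card]
      have hsub : d.1 \ b.1 ⊆ (x.1 ∩ d.1) ∪ (b.1 ∪ x.1)ᶜ := by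
        intro i
        simp only [Finset.mem_sdiff, Finset.mem_union, Finset.mem_inter, Finset.mem_compl]
        tauto
      have h2 := (Finset.card_le_card hsub).trans (Finset.card_union_le _ _)
      have h3 : (b.1 ∪ x.1)ᶜ.card = 1 := by
        rw [Finset.card_compl, Fintype.card_fin, Finset.card_union_of_disjoint h.2, b.2, x.2]
        omega
      omega
    · have h1 := (ih j).1 (by omega)
      rw [card_sdiff_comm_of_card] at h1
      refine (Finset.card_le_card ?_).trans h1
      intro i hi
      rw [Finset.mem_inter] at hi
      exact Finset.mem_sdiff.2 ⟨hi.2, fun hx => Finset.disjoint_left.1 h.2 hi.1 hx⟩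

/-- Exchanging one element of a set. -/
theorem card_insert_erase {u : Finset (Fin N)} {i j : Fin N} (hi : i ∈ u) (hj : j ∉ u) :
    (insert j (u.erase i)).card = u.card := by
  rw [Finset.card_insert_of_notMem fun h => hj (Finset.mem_of_mem_erase h),
    Finset.card_erase_add_one hi]

theorem oddGraph_exists_even_walk (hN : N = 2 * k + 1) (hk : 1 ≤ k) (j : ℕ)
    (a c : {u : Finset (Fin N) // u.card = k}) (h : (a.1 \ c.1).card = j) :
    ∃ w : (kneserGraph N k).Walk a c, w.length = 2 * j := by
  induction j generalizing a with
  | zero =>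
    have hsub : a.1 ⊆ c.1 := Finset.sdiff_eq_empty_iff_subset.1 (Finset.card_eq_zero.1 h)
    obtain rfl : a = c := Subtype.ext (Finset.eq_of_subset_of_card_le hsub (by rw [a.2, c.2]))
    exact ⟨.nil, rfl⟩
  | succ j ih =>
    obtain ⟨i, hi⟩ : (a.1 \ c.1).Nonempty := Finset.card_pos.1 (by omega)
    obtain ⟨l, hl⟩ : (c.1 \ a.1).Nonempty :=
      Finset.card_pos.1 (by rw [card_sdiff_comm_of_card]; omega)
    rw [Finset.mem_sdiff] at hi hl
    let a' : {u : Finset (Fin N) // u.card = k} :=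
      ⟨insert l (a.1.erase i), by rw [card_insert_erase hi.1 hl.2, a.2]⟩
    have hsd : a'.1 \ c.1 = (a.1 \ c.1).erase i := by
      ext t
      simp only [a', Finset.mem_sdiff, Finset.mem_insert, Finset.mem_erase]
      grind
    have hinter : a.1 ∩ a'.1 = a.1.erase i := by
      ext t
      simp only [a', Finset.mem_inter, Finset.mem_insert, Finset.mem_erase]
      grind
    obtain ⟨w, hw⟩ := ih a' (by
      rw [hsd, Finset.card_erase_of_mem (Finset.mem_sdiff.2 hi), h, Nat.add_sub_cancel])
    obtain ⟨x, hx, hx'⟩ := exists_common_neighbor hN (u := a) (v := a') (by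
      rw [hinter, Finset.card_erase_add_one hi.1, a.2])
    refine ⟨.cons ((kneserGraph_adj_iff_disjoint hk).2 hx)
      (.cons ((kneserGraph_adj_iff_disjoint hk).2 hx'.symm) w), ?_⟩
    simp only [SimpleGraph.Walk.length_cons, hw]
    ring

theorem oddGraph_exists_odd_walk (hN : N = 2 * k + 1) (hk : 1 ≤ k) (j : ℕ)
    (a c : {u : Finset (Fin N) // u.card = k}) (h : (a.1 ∩ c.1).card = j) :
    ∃ w : (kneserGraph N k).Walk a c, w.length = 2 * j + 1 := by
  -- The last edge comes from a neighbour `x` of `c` containing `a \ c`, so that `a \ x = a ∩ c`.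
  obtain ⟨x, hax, hxc, hx⟩ := Finset.exists_subsuperset_card_eq (s := a.1 \ c.1) (t := c.1ᶜ)
    (n := k) (fun i hi => Finset.mem_compl.2 (Finset.mem_sdiff.1 hi).2)
    ((Finset.card_le_card Finset.sdiff_subset).trans a.2.le)
    (by rw [Finset.card_compl, Fintype.card_fin, c.2]; omega)
  have hxc' : Disjoint x c.1 := Finset.disjoint_left.2 fun i hi => Finset.mem_compl.1 (hxc hi)
  have hsd : a.1 \ x = a.1 ∩ c.1 := by
    ext i
    have h1 := @hax i
    have h2 := @hxc i
    simp only [Finset.mem_sdiff, Finset.mem_inter, Finset.mem_compl] at h1 h2 ⊢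
    tauto
  obtain ⟨w, hw⟩ := oddGraph_exists_even_walk hN hk j a ⟨x, hx⟩ (by rw [hsd, h])
  exact ⟨w.concat ((kneserGraph_adj_iff_disjoint hk).2 hxc'), by simp [hw]⟩

/-- A permutation of the ground set matching two pairs of sets. -/
theorem exists_perm_map_eq {a b c d : Finset (Fin N)} (hab : b.card = a.card)
    (hcd : d.card = c.card) (h : (b ∩ d).card = (a ∩ c).card) :
    ∃ σ : Equiv.Perm (Fin N), b.map σ.toEmbedding = a ∧ d.map σ.toEmbedding = c := by
  -- The two sets cut the ground set into four regions, whose sizes are determined by the given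
  -- cardinalities.
  have hcard : ∀ r : Bool × Bool,
      Fintype.card {x // (decide (x ∈ b), decide (x ∈ d)) = r} =
        Fintype.card {x // (decide (x ∈ a), decide (x ∈ c)) = r} := by
    have hb := Finset.card_sdiff_add_card_inter b d
    have ha := Finset.card_sdiff_add_card_inter a c
    have hd := Finset.card_sdiff_add_card_inter d b
    have hc := Finset.card_sdiff_add_card_inter c a
    have hbd := Finset.card_union_add_card_inter b d
    have hac := Finset.card_union_add_card_inter a c
    rw [Finset.inter_comm] at hd hc
    have key : ∀ s t : Finset (Fin N), ∀ r : Bool × Bool,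
        Fintype.card {x // (decide (x ∈ s), decide (x ∈ t)) = r} =
          match r with
          | (true, true) => (s ∩ t).card
          | (true, false) => (s \ t).card
          | (false, true) => (t \ s).card
          | (false, false) => (s ∪ t)ᶜ.card := by
      rintro s t ⟨_ | _, _ | _⟩ <;> rw [Fintype.card_subtype] <;> congr 1 <;> ext x <;>
        simp [and_comm]
    intro r
    rw [key, key]
    rcases r with ⟨_ | _, _ | _⟩
    · simp only [Finset.card_compl]
      omega
    · simp only
      omega
    · simp only
      omega
    · exact h
  let e : ∀ r : Bool × Bool, {x // (decide (x ∈ b), decide (x ∈ d)) = r} ≃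
      {x // (decide (x ∈ a), decide (x ∈ c)) = r} := fun r => Fintype.equivOfCardEq (hcard r)
  have hσ := fun x => Equiv.ofFiberEquiv_map e x
  refine ⟨Equiv.ofFiberEquiv e, ?_, ?_⟩
  · refine Finset.eq_of_subset_of_card_le ?_ (by rw [Finset.card_map, hab])
    intro y hy
    obtain ⟨x, hx, rfl⟩ := Finset.mem_map.1 hy
    simpa [hx] using congrArg Prod.fst (hσ x)
  · refine Finset.eq_of_subset_of_card_le ?_ (by rw [Finset.card_map, hcd])
    intro y hy
    obtain ⟨x, hx, rfl⟩ := Finset.mem_map.1 hy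
    simpa [hx] using congrArg Prod.snd (hσ x)

/-- The strict inequality for `eq_zero_of_card_lt`. Without the condition on `b'`, the first set
embeds into the second by a permutation taking `(b, d)` to `(a, c)`; the condition on `b' ≠ b`
removes at least one element. -/
theorem card_lt_card_exchange {a b b' c d : {u : Finset (Fin N) // u.card = k}} {m : ℕ}
    (hac : (a.1 ∩ c.1).card = m) (hbd : (b.1 ∩ d.1).card = m) (hbd' : (b'.1 ∩ d.1).card = m)
    (hm : m < k) (hb : b ≠ b') :
    {z : {u : Finset (Fin N) // u.card = k} | (z.1 ∩ d.1).card + 1 = k ∧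
        (z.1 ∩ b.1).card = m + 1 ∧ (z.1 ∩ b'.1).card = m + 1}.toFinset.card <
      {t : {u : Finset (Fin N) // u.card = k} | (t.1 ∩ c.1).card + 1 = k ∧
        (t.1 ∩ a.1).card = m + 1}.toFinset.card := by
  -- Otherwise `b'` contains `b \ d` and misses `d \ b`, which with `|b ∩ d| = |b' ∩ d|` forces `b =
  -- b'`.
  have hex : ∃ i ∈ b.1 \ d.1, ∃ j ∈ d.1 \ b.1, i ∉ b'.1 ∨ j ∈ b'.1 := by
    by_contra! h
    have h1 := card_sdiff_add_card_inter_eq b d.1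
    obtain ⟨i₀, hi₀⟩ : (b.1 \ d.1).Nonempty := Finset.card_pos.1 (by omega)
    obtain ⟨j₀, hj₀⟩ : (d.1 \ b.1).Nonempty :=
      Finset.card_pos.1 (by rw [card_sdiff_comm_of_card]; omega)
    have hsub : b'.1 ∩ d.1 ⊆ b.1 ∩ d.1 := by
      intro j hj
      rw [Finset.mem_inter] at hj ⊢
      refine ⟨?_, hj.2⟩
      by_contra hjb
      exact (h i₀ hi₀ j (Finset.mem_sdiff.2 ⟨hj.2, hjb⟩)).2 hj.1
    have heq := Finset.eq_of_subset_of_card_le hsub (by rw [hbd, hbd'])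
    have hbb : b.1 ⊆ b'.1 := by
      intro i hi
      by_cases hid : i ∈ d.1
      · have : i ∈ b'.1 ∩ d.1 := heq ▸ Finset.mem_inter.2 ⟨hi, hid⟩
        exact (Finset.mem_inter.1 this).1
      · exact (h i (Finset.mem_sdiff.2 ⟨hi, hid⟩) j₀ hj₀).1
    exact hb (Subtype.ext (Finset.eq_of_subset_of_card_le hbb (by rw [b.2, b'.2])))
  obtain ⟨i, hi, j, hj, hij⟩ := hex
  rw [Finset.mem_sdiff] at hi hj
  obtain ⟨σ, hσb, hσd⟩ := exists_perm_map_eq (b.2.trans a.2.symm) (d.2.trans c.2.symm)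
    (hbd.trans hac.symm)
  -- Trading `j` for `i` in `d` gains a point of `b` but, by the choice of `i` and `j`, none on
  -- balance in `b'`.
  let z₀ : {u : Finset (Fin N) // u.card = k} :=
    ⟨insert i (d.1.erase j), by rw [card_insert_erase hj.1 hi.2, d.2]⟩
  have hz₀d : (z₀.1 ∩ d.1).card + 1 = k := by
    have : z₀.1 ∩ d.1 = d.1.erase j := by
      ext t
      simp only [z₀, Finset.mem_inter, Finset.mem_insert, Finset.mem_erase]
      grind
    rw [this, Finset.card_erase_add_one hj.1, d.2]
  have hz₀b : (z₀.1 ∩ b.1).card = m + 1 := by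
    have : z₀.1 ∩ b.1 = insert i (b.1 ∩ d.1) := by
      ext t
      simp only [z₀, Finset.mem_inter, Finset.mem_insert, Finset.mem_erase]
      grind
    rw [this, Finset.card_insert_of_notMem (by simp [hi.2]), hbd]
  have hz₀b' : (z₀.1 ∩ b'.1).card ≠ m + 1 := by
    refine ne_of_lt (Nat.lt_succ_of_le ?_)
    rcases hij with hib' | hjb'
    · rw [← hbd']
      refine Finset.card_le_card fun t => ?_
      simp only [z₀, Finset.mem_inter, Finset.mem_insert, Finset.mem_erase]
      grind
    · have hsub : z₀.1 ∩ b'.1 ⊆ insert i ((b'.1 ∩ d.1).erase j) := by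
        intro t
        simp only [z₀, Finset.mem_inter, Finset.mem_insert, Finset.mem_erase]
        grind
      refine (Finset.card_le_card hsub).trans ((Finset.card_insert_le _ _).trans ?_)
      rw [Finset.card_erase_add_one (Finset.mem_inter.2 ⟨hjb', hj.1⟩), hbd']
  have hlt : {z : {u : Finset (Fin N) // u.card = k} | (z.1 ∩ d.1).card + 1 = k ∧
        (z.1 ∩ b.1).card = m + 1 ∧ (z.1 ∩ b'.1).card = m + 1}.toFinset.card <
      {z : {u : Finset (Fin N) // u.card = k} | (z.1 ∩ d.1).card + 1 = k ∧
        (z.1 ∩ b.1).card = m + 1}.toFinset.card := by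
    refine Finset.card_lt_card ((Finset.ssubset_iff_of_subset ?_).2 ⟨z₀, ?_, ?_⟩)
    · intro z
      simp only [Set.mem_toFinset, Set.mem_ofPred_eq]
      exact fun h => ⟨h.1, h.2.1⟩
    · simp only [Set.mem_toFinset, Set.mem_ofPred_eq]
      exact ⟨hz₀d, hz₀b⟩
    · simp only [Set.mem_toFinset, Set.mem_ofPred_eq]
      exact fun h => hz₀b' h.2.2
  refine hlt.trans_le (Finset.card_le_card_of_injOn
    (fun z => ⟨z.1.map σ.toEmbedding, by rw [Finset.card_map, z.2]⟩) ?_ ?_)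
  · intro z hz
    simp only [Set.coe_toFinset, Set.mem_ofPred_eq] at hz ⊢
    rw [← hσb, ← hσd, ← Finset.map_inter, ← Finset.map_inter, Finset.card_map, Finset.card_map]
    exact hz
  · intro z _ z' _ h
    exact Subtype.ext (Finset.map_injective _ (congrArg Subtype.val h))

/-- Two vertices `a₀`, `a₂` with a common neighbour `a₁` lie on a closed walk
`a₀, a₁, a₂, d, a₂', a₁'` with `a₁ ≠ a₁'`. -/
theorem oddGraph_exists_hexagon (hN : N = 2 * k + 1)
    {a₀ a₁ a₂ : {u : Finset (Fin N) // u.card = k}} (h : (a₀.1 ∩ a₂.1).card + 1 = k)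
    (h01 : Disjoint a₀.1 a₁.1) (h21 : Disjoint a₂.1 a₁.1) :
    ∃ d a₂' a₁' : {u : Finset (Fin N) // u.card = k}, Disjoint a₂.1 d.1 ∧ d ≠ a₁ ∧
      (a₀.1 ∩ d.1).card = 1 ∧ Disjoint a₂'.1 d.1 ∧ (a₀.1 ∩ a₂'.1).card + 1 = k ∧
      Disjoint a₀.1 a₁'.1 ∧ Disjoint a₂'.1 a₁'.1 ∧ a₁ ≠ a₁' := by
  have h1 := card_sdiff_add_card_inter_eq a₀ a₂.1
  obtain ⟨l, hl⟩ : ∃ l, a₀.1 \ a₂.1 = {l} := Finset.card_eq_one.1 (by omega)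
  obtain ⟨i, hi⟩ : ∃ i, a₂.1 \ a₀.1 = {i} :=
    Finset.card_eq_one.1 (by rw [card_sdiff_comm_of_card]; omega)
  obtain ⟨s, hs⟩ : a₁.1.Nonempty := Finset.card_pos.1 (by rw [a₁.2]; omega)
  have hl' : ∀ t, (t ∈ a₀.1 ∧ t ∉ a₂.1) ↔ t = l := fun t => by
    rw [← Finset.mem_sdiff, hl, Finset.mem_singleton]
  have hi' : ∀ t, (t ∈ a₂.1 ∧ t ∉ a₀.1) ↔ t = i := fun t => by
    rw [← Finset.mem_sdiff, hi, Finset.mem_singleton]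
  have hd0 : ∀ t, t ∈ a₀.1 → t ∉ a₁.1 := fun t ht => Finset.disjoint_left.1 h01 ht
  have hd2 : ∀ t, t ∈ a₂.1 → t ∉ a₁.1 := fun t ht => Finset.disjoint_left.1 h21 ht
  have hll := (hl' l).2 rfl
  have hii := (hi' i).2 rfl
  let d : {u : Finset (Fin N) // u.card = k} :=
    ⟨insert l (a₁.1.erase s), by rw [card_insert_erase hs (hd0 l hll.1), a₁.2]⟩
  let a₂' : {u : Finset (Fin N) // u.card = k} :=
    ⟨insert s (a₂.1.erase i), by rw [card_insert_erase hii.1 fun h => hd2 s h hs, a₂.2]⟩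
  have hinter : a₀.1 ∩ a₂'.1 = a₀.1 ∩ a₂.1 := by
    ext t
    simp only [a₂', Finset.mem_inter, Finset.mem_insert, Finset.mem_erase]
    grind
  obtain ⟨a₁', h01', h21'⟩ := exists_common_neighbor hN (u := a₀) (v := a₂') (by rw [hinter, h])
  refine ⟨d, a₂', a₁', ?_, ?_, ?_, ?_, by rw [hinter, h], h01', h21', ?_⟩
  · rw [Finset.disjoint_left]
    intro t ht
    simp only [d, Finset.mem_insert, Finset.mem_erase]
    grind
  · intro h
    have : l ∈ a₁.1 := h ▸ Finset.mem_insert_self _ _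
    exact hd0 l hll.1 this
  · rw [Finset.card_eq_one]
    refine ⟨l, ?_⟩
    ext t
    simp only [d, Finset.mem_inter, Finset.mem_insert, Finset.mem_erase, Finset.mem_singleton]
    grind
  · rw [Finset.disjoint_left]
    intro t ht
    simp only [d, a₂', Finset.mem_insert, Finset.mem_erase] at ht ⊢
    grind
  · rintro rfl
    exact Finset.disjoint_left.1 h21' (Finset.mem_insert_self _ _) hs

/-- By cardinality `b ∩ x = b \ q` and `c ∩ x = c \ q`, so `x` contains `(b ∪ c) \ q`; here `b ∪ c`
is the complement of `y`, and the sizes agree. -/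
theorem eq_compl_sdiff_of_card_inter (hN : N = 2 * k + 1)
    {b c y q x : {u : Finset (Fin N) // u.card = k}} (hbc : b ≠ c) (hby : Disjoint b.1 y.1)
    (hcy : Disjoint c.1 y.1) (hyq : (y.1 ∩ q.1).card + 1 = k) (hbq : (b.1 ∩ q.1).card = 1)
    (hcq : (c.1 ∩ q.1).card = 1) (hxq : Disjoint x.1 q.1) (hbx : (b.1 ∩ x.1).card + 1 = k)
    (hcx : (c.1 ∩ x.1).card + 1 = k) : x.1 = y.1ᶜ \ q.1 := by
  have key : ∀ b : {u : Finset (Fin N) // u.card = k}, (b.1 ∩ q.1).card = 1 →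
      (b.1 ∩ x.1).card + 1 = k → b.1 \ q.1 ⊆ x.1 := by
    intro b hbq hbx
    have h1 := card_sdiff_add_card_inter_eq b q.1
    have hsub : b.1 ∩ x.1 ⊆ b.1 \ q.1 := fun i hi => by
      rw [Finset.mem_inter] at hi
      exact Finset.mem_sdiff.2 ⟨hi.1, Finset.disjoint_left.1 hxq hi.2⟩
    rw [← Finset.eq_of_subset_of_card_le hsub (by omega)]
    exact Finset.inter_subset_right
  have hy := (eq_compl_union_of_disjoint hN hbc hby hcy).1
  have hsub : y.1ᶜ \ q.1 ⊆ x.1 := by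
    rw [hy, compl_compl, Finset.union_sdiff_distrib]
    exact Finset.union_subset (key b hbq hbx) (key c hcq hcx)
  refine (Finset.eq_of_subset_of_card_le hsub ?_).symm
  have hcompl : y.1ᶜ \ q.1 = (y.1 ∪ q.1)ᶜ := by
    ext i
    simp
  have := card_union_add_card_inter_eq y q
  rw [hcompl, Finset.card_compl, Fintype.card_fin, x.2]
  omega

end Kneser

/-! ### Norm estimate for the counting argument -/

namespace IsQuantumEndomorphism

section Counting

variable {V : Type} [Fintype V] {G : SimpleGraph V} {B : Type*} [CStarAlgebra B] {p : V → V → B}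

theorem norm_sum_le_one (hp : IsQuantumEndomorphism G p) (T : Finset V) (z : V)
    (hT : ∀ t ∈ T, ∀ t' ∈ T, t ≠ t' → p t z * p t' z = 0) : ‖∑ t ∈ T, p t z‖ ≤ 1 := by
  set q := ∑ t ∈ T, p t z with hq
  have hstar : star q = q := by
    rw [hq, star_sum]
    exact Finset.sum_congr rfl fun t _ => hp.star_eq t z
  have hmul : q * q = q := by
    rw [hq, Finset.sum_mul]
    refine Finset.sum_congr rfl fun t ht => ?_
    rw [Finset.mul_sum, Finset.sum_eq_single t, hp.mul_self]
    · exact fun t' ht' h => hT t ht t' ht' h.symm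
    · exact fun h => absurd ht h
  have h : ‖q‖ = ‖q‖ * ‖q‖ := by
    rw [← CStarRing.norm_star_mul_self, hstar, hmul]
  nlinarith [norm_nonneg q]

/-- If the rows in `T` have orthogonal columns and `E` is supported, in each of these rows, on fewer
than `#T` columns, then `E = 0`. -/
theorem eq_zero_of_card_lt (hp : IsQuantumEndomorphism G p) {T Z : Finset V} {E : B}
    (hT : ∀ z, ∀ t ∈ T, ∀ t' ∈ T, t ≠ t' → p t z * p t' z = 0)
    (hZ : ∀ t ∈ T, ∀ z, z ∉ Z → p t z * E = 0) (hcard : Z.card < T.card) : E = 0 := by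
  have h1 : ∀ t ∈ T, ∑ z ∈ Z, p t z * E = E := by
    intro t ht
    rw [Finset.sum_subset (Finset.subset_univ Z) fun z _ hz => hZ t ht z hz, ← Finset.sum_mul,
      hp.sum_eq_one, one_mul]
  -- Double counting: each row of `T` contributes `E`, while each column of `Z` contributes a
  -- projection times `E`, of norm at most `‖E‖`.
  have h2 : ∑ z ∈ Z, (∑ t ∈ T, p t z) * E = (T.card : ℂ) • E := by
    simp_rw [Finset.sum_mul]
    rw [Finset.sum_comm, Finset.sum_congr rfl h1, Finset.sum_const, Nat.cast_smul_eq_nsmul]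
  have h3 : (T.card : ℝ) * ‖E‖ ≤ Z.card * ‖E‖ := by
    calc (T.card : ℝ) * ‖E‖ = ‖(T.card : ℂ) • E‖ := by rw [norm_smul, Complex.norm_natCast]
      _ ≤ ∑ z ∈ Z, ‖(∑ t ∈ T, p t z) * E‖ := h2 ▸ norm_sum_le _ _
      _ ≤ ∑ z ∈ Z, ‖E‖ := Finset.sum_le_sum fun z _ =>
          (norm_mul_le _ _).trans (mul_le_of_le_one_left (norm_nonneg _)
            (hp.norm_sum_le_one T z (hT z)))
      _ = Z.card * ‖E‖ := by rw [Finset.sum_const, nsmul_eq_mul]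
  have h4 : (Z.card : ℝ) < T.card := by exact_mod_cast hcard
  rw [← norm_eq_zero]
  nlinarith [norm_nonneg E]

end Counting

/-! ### Commutation for odd graphs -/

section OddGraph

variable {N k : ℕ} {B : Type*} [CStarAlgebra B]
  {p : {u : Finset (Fin N) // u.card = k} → {u : Finset (Fin N) // u.card = k} → B}

/-- A nonzero product would transport an even and an odd walk, giving `|b \ d| ≤ |a \ c|` and `|b ∩
d| ≤ |a ∩ c|`; both pairs sum to `k`, so equality holds. With `b = d` this also makes columns
orthogonal. -/
theorem odd_mul_eq_zero (hp : IsQuantumEndomorphism (kneserGraph N k) p) (hN : N = 2 * k + 1)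
    (hk : 1 ≤ k) {a b c d : {u : Finset (Fin N) // u.card = k}}
    (h : (a.1 ∩ c.1).card ≠ (b.1 ∩ d.1).card) : p a b * p c d = 0 := by
  by_contra h0
  obtain ⟨w, hw⟩ := oddGraph_exists_even_walk hN hk _ a c rfl
  obtain ⟨v, hv⟩ := oddGraph_exists_odd_walk hN hk _ a c rfl
  obtain ⟨w', hw'⟩ := hp.exists_walk w h0
  obtain ⟨v', hv'⟩ := hp.exists_walk v h0
  have h1 := (oddGraph_card_le_of_walk hN w' _).1 (hw'.trans hw)
  have h2 := (oddGraph_card_le_of_walk hN v' _).2 (hv'.trans hv)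
  have h3 := card_sdiff_add_card_inter_eq a c.1
  have h4 := card_sdiff_add_card_inter_eq b d.1
  omega

theorem odd_mul_eq_zero_of_card_swap (hp : IsQuantumEndomorphism (kneserGraph N k) p)
    (hN : N = 2 * k + 1) (hk : 1 ≤ k) {a b c d : {u : Finset (Fin N) // u.card = k}}
    (h : (c.1 ∩ a.1).card ≠ (d.1 ∩ b.1).card) : p a b * p c d = 0 :=
  hp.mul_eq_zero_comm.1 (hp.odd_mul_eq_zero hN hk h)

theorem odd_commute_of_disjoint (hp : IsQuantumEndomorphism (kneserGraph N k) p)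
    (hN : N = 2 * k + 1) (hk : 1 ≤ k) {a c : {u : Finset (Fin N) // u.card = k}}
    (hac : Disjoint a.1 c.1) (b d : {u : Finset (Fin N) // u.card = k}) :
    Commute (p a b) (p c d) :=
  hp.commute_of_adj (fun _ _ _ _ h hx hx' hy hy' => eq_of_common_neighbors hN h hx.2 hx'.2 hy.2 hy'.2)
    ((kneserGraph_adj_iff_disjoint hk).2 hac) b d

theorem odd_mul_eq_zero_of_disjoint (hp : IsQuantumEndomorphism (kneserGraph N k) p)
    (hk : 1 ≤ k) {a b c d : {u : Finset (Fin N) // u.card = k}} (hac : Disjoint a.1 c.1)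
    (hbd : ¬ Disjoint b.1 d.1) : p a b * p c d = 0 :=
  hp.mul_eq_zero _ _ _ _ ((kneserGraph_adj_iff_disjoint hk).2 hac) fun h => hbd h.2

/-- Common neighbours are mapped to common neighbours. -/
theorem odd_common_neighbor_mul (hp : IsQuantumEndomorphism (kneserGraph N k) p)
    (hN : N = 2 * k + 1) (hk : 1 ≤ k) {a₀ a₁ a₂ b₀ b₂ y : {u : Finset (Fin N) // u.card = k}}
    (h01 : Disjoint a₀.1 a₁.1) (h21 : Disjoint a₂.1 a₁.1) (hb : b₀ ≠ b₂)
    (h0y : Disjoint b₀.1 y.1) (h2y : Disjoint b₂.1 y.1) :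
    p a₁ y * (p a₀ b₀ * p a₂ b₂) = p a₀ b₀ * p a₂ b₂ := by
  have h := hp.mul_mul_eq_mul a₁ y (x := 1) (y := p a₀ b₀ * p a₂ b₂) ?_
  · simpa only [one_mul] using h
  · intro y' hy'
    rw [one_mul]
    by_cases h0 : Disjoint b₀.1 y'.1
    · have h2 : ¬ Disjoint b₂.1 y'.1 := fun h2 =>
        hy' (eq_of_common_neighbors hN hb h0 h2 h0y h2y)
      rw [← mul_assoc, ← (hp.odd_commute_of_disjoint hN hk h01 b₀ y').eq, mul_assoc,
        hp.odd_mul_eq_zero_of_disjoint hk h21.symm (fun h => h2 h.symm), mul_zero]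
    · rw [← mul_assoc, hp.odd_mul_eq_zero_of_disjoint hk h01.symm (fun h => h0 h.symm), zero_mul]

/-- The factor of row `a₂` can be dropped, since `b₂` is the only column of that row compatible with
`b₀`, `q` and `c` (`eq_compl_sdiff_of_card_inter`). The result no longer depends on `a₂`. -/
theorem odd_mul_mul_mul_eq (hp : IsQuantumEndomorphism (kneserGraph N k) p)
    (hN : N = 2 * k + 1) (hk : 1 ≤ k)
    {a₀ a₂ d b₀ b₂ c y q : {u : Finset (Fin N) // u.card = k}}
    (h02 : (a₀.1 ∩ a₂.1).card + 1 = k) (h2d : Disjoint a₂.1 d.1) (hbc : b₀ ≠ c)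
    (hby : Disjoint b₀.1 y.1) (hcy : Disjoint c.1 y.1) (hyq : (y.1 ∩ q.1).card + 1 = k)
    (hbq : (b₀.1 ∩ q.1).card = 1) (hcq : (c.1 ∩ q.1).card = 1) (h2q : Disjoint b₂.1 q.1)
    (hb2 : (b₀.1 ∩ b₂.1).card + 1 = k) (hc2 : (c.1 ∩ b₂.1).card + 1 = k) :
    p a₀ b₀ * p a₂ b₂ * p d q * p a₀ c = p a₀ b₀ * p d q * p a₀ c := by
  have hcomm := fun x => (hp.odd_commute_of_disjoint hN hk h2d x q).eq
  rw [mul_assoc (p a₀ b₀), hcomm, ← mul_assoc]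
  refine hp.mul_mul_eq_mul a₂ b₂ fun x hx => ?_
  by_cases hxq : Disjoint x.1 q.1
  · by_cases hbx : (b₀.1 ∩ x.1).card + 1 = k
    · have hcx : (c.1 ∩ x.1).card + 1 ≠ k := fun hcx => hx (Subtype.ext
        ((eq_compl_sdiff_of_card_inter hN hbc hby hcy hyq hbq hcq hxq hbx hcx).trans
          (eq_compl_sdiff_of_card_inter hN hbc hby hcy hyq hbq hcq h2q hb2 hc2).symm))
      have h0 : p a₂ x * p a₀ c = 0 :=
        hp.odd_mul_eq_zero_of_card_swap hN hk fun h => hcx (h ▸ h02)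
      rw [mul_assoc, h0, mul_zero]
    · have h0 : p a₀ b₀ * p a₂ x = 0 := hp.odd_mul_eq_zero hN hk fun h => hbx (h ▸ h02)
      rw [mul_assoc (p a₀ b₀), ← hcomm, ← mul_assoc, h0, zero_mul, zero_mul]
  · rw [mul_assoc (p a₀ b₀), hp.odd_mul_eq_zero_of_disjoint hk h2d.symm (fun h => hxq h.symm),
      mul_zero, zero_mul]

theorem odd_commute_of_card_inter_add_one (hp : IsQuantumEndomorphism (kneserGraph N k) p)
    (hN : N = 2 * k + 1) (hk : 1 ≤ k) {a₀ a₂ : {u : Finset (Fin N) // u.card = k}}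
    (h02 : (a₀.1 ∩ a₂.1).card + 1 = k) (b₀ b₂ : {u : Finset (Fin N) // u.card = k}) :
    Commute (p a₀ b₀) (p a₂ b₂) := by
  refine hp.commute_of_mul_mul_eq_zero fun c hc => ?_
  by_cases hb2 : (b₀.1 ∩ b₂.1).card + 1 = k
  swap
  · have h0 : p a₀ b₀ * p a₂ b₂ = 0 := hp.odd_mul_eq_zero hN hk fun h => hb2 (h ▸ h02)
    rw [h0, zero_mul]
  by_cases hc2 : (c.1 ∩ b₂.1).card + 1 = k
  swap
  · have h0 : p a₂ b₂ * p a₀ c = 0 :=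
      hp.odd_mul_eq_zero_of_card_swap hN hk fun h => hc2 (h ▸ h02)
    rw [mul_assoc, h0, mul_zero]
  have hb02 : b₀ ≠ b₂ := by
    rintro rfl
    rw [Finset.inter_self, b₀.2] at hb2
    omega
  obtain ⟨a₁, h01, h21⟩ := exists_common_neighbor hN h02
  obtain ⟨y, h0y, h2y⟩ := exists_common_neighbor hN hb2
  have hP := hp.odd_common_neighbor_mul hN hk h01 h21 hb02 h0y h2y
  have hPcomm : Commute (p a₁ y) (p a₀ b₀ * p a₂ b₂) :=
    (hp.odd_commute_of_disjoint hN hk h01.symm _ _).mul_right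
      (hp.odd_commute_of_disjoint hN hk h21.symm _ _)
  by_cases hcy : Disjoint c.1 y.1
  swap
  · rw [← hP, hPcomm.eq, mul_assoc _ (p a₁ y),
      hp.odd_mul_eq_zero_of_disjoint hk h01.symm (fun h => hcy h.symm), mul_zero]
  obtain ⟨d, a₂', a₁', h2d, hd1, h0d, h2d', h02', h01', h21', h11'⟩ :=
    oddGraph_exists_hexagon hN h02 h01 h21
  have h1d := (eq_compl_union_of_disjoint hN hd1 h2d.symm h21.symm).2
  -- The fourth vertex `d` of the hexagon is inserted; all columns `q` not in the position required
  -- by `odd_mul_mul_mul_eq` drop out.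
  refine hp.mul_eq_zero_of_forall d fun q => ?_
  by_cases h2q : Disjoint b₂.1 q.1
  swap
  · rw [mul_assoc (p a₀ b₀), hp.odd_mul_eq_zero_of_disjoint hk h2d h2q, mul_zero, zero_mul]
  by_cases hyq : (y.1 ∩ q.1).card + 1 = k
  swap
  · have h0 : p a₁ y * p d q = 0 := by
      refine hp.odd_mul_eq_zero_of_card_swap hN hk fun h => hyq ?_
      rw [Finset.inter_comm, ← h, h1d]
    rw [← hP, hPcomm.eq, mul_assoc _ (p a₁ y), h0, mul_zero, zero_mul]
  by_cases hbq : (b₀.1 ∩ q.1).card = 1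
  swap
  · have h0 : p a₀ b₀ * p d q = 0 := hp.odd_mul_eq_zero hN hk fun h => hbq (h ▸ h0d)
    rw [mul_assoc (p a₀ b₀), (hp.odd_commute_of_disjoint hN hk h2d b₂ q).eq, ← mul_assoc, h0,
      zero_mul, zero_mul]
  by_cases hcq : (c.1 ∩ q.1).card = 1
  swap
  · have h0 : p d q * p a₀ c = 0 :=
      hp.odd_mul_eq_zero_of_card_swap hN hk fun h => hcq (h ▸ h0d)
    rw [mul_assoc, h0, mul_zero]
  have hF := hp.odd_mul_mul_mul_eq hN hk h02 h2d hc.symm h0y hcy hyq hbq hcq h2q hb2 hc2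
  have hF' := hp.odd_mul_mul_mul_eq hN hk h02' h2d' hc.symm h0y hcy hyq hbq hcq h2q hb2 hc2
  have hP' := hp.odd_common_neighbor_mul hN hk h01' h21' hb02 h0y h2y
  -- The same element arises from `a₂` and from `a₂'`, so it is fixed by both `p a₁ y` and `p a₁'
  -- y`, which are orthogonal.
  have h1 : p a₁' y * (p a₀ b₀ * p d q * p a₀ c) = p a₀ b₀ * p d q * p a₀ c := by
    rw [← hF', ← mul_assoc, ← mul_assoc, hP']
  have h0 : p a₁ y * p a₁' y = 0 := by
    refine hp.odd_mul_eq_zero hN hk ?_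
    rw [Finset.inter_self, y.2]
    exact card_inter_ne_of_ne h11'
  rw [← hP, mul_assoc (p a₁ y), mul_assoc (p a₁ y), hF, ← h1, ← mul_assoc, h0, zero_mul]

/-- The counting rows `t` have `|t ∩ c| = k - 1` and `|t ∩ a| = m + 1`, so they commute with rows
`c` and `a`. Hence `p t z` can be moved next to each factor of `p a b * p c d * p a b'`, and only
columns `z` in the right position to `b`, `d` and `b'` survive. -/
theorem odd_commute_of_card_inter_eq (hp : IsQuantumEndomorphism (kneserGraph N k) p)
    (hN : N = 2 * k + 1) (hk : 1 ≤ k) {m : ℕ} (hm : m < k)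
    (ih : ∀ a c : {u : Finset (Fin N) // u.card = k}, (a.1 ∩ c.1).card = m + 1 →
      ∀ b d, Commute (p a b) (p c d))
    {a c : {u : Finset (Fin N) // u.card = k}} (hac : (a.1 ∩ c.1).card = m)
    (b d : {u : Finset (Fin N) // u.card = k}) : Commute (p a b) (p c d) := by
  refine hp.commute_of_mul_mul_eq_zero fun b' hb' => ?_
  by_cases hbd : (b.1 ∩ d.1).card = m
  swap
  · rw [hp.odd_mul_eq_zero hN hk fun h => hbd (h ▸ hac), zero_mul]
  by_cases hbd' : (b'.1 ∩ d.1).card = m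
  swap
  · have h0 : p c d * p a b' = 0 :=
      hp.odd_mul_eq_zero_of_card_swap hN hk fun h => hbd' (h ▸ hac)
    rw [mul_assoc, h0, mul_zero]
  refine hp.eq_zero_of_card_lt ?_ ?_ (card_lt_card_exchange hac hbd hbd' hm hb'.symm)
  · intro z t _ t' _ htt
    refine hp.odd_mul_eq_zero hN hk ?_
    rw [Finset.inter_self, z.2]
    exact card_inter_ne_of_ne htt
  · intro t ht z hz
    simp only [Set.mem_toFinset, Set.mem_ofPred_eq] at ht hz
    have hta : ∀ x, Commute (p t z) (p a x) := ih t a ht.2 z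
    have htc : Commute (p t z) (p c d) := hp.odd_commute_of_card_inter_add_one hN hk ht.1 z d
    by_cases hzb : (z.1 ∩ b.1).card = m + 1
    · by_cases hzd : (z.1 ∩ d.1).card + 1 = k
      · rw [← mul_assoc, ((hta b).mul_right htc).eq, mul_assoc,
          hp.odd_mul_eq_zero hN hk (a := t) (c := a), mul_zero]
        exact fun h => hz ⟨hzd, hzb, h ▸ ht.2⟩
      · rw [← mul_assoc, ← mul_assoc, (hta b).eq, mul_assoc (p a b),
          hp.odd_mul_eq_zero hN hk (a := t) (c := c) fun h => hzd (h ▸ ht.1), mul_zero, zero_mul]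
    · rw [← mul_assoc, ← mul_assoc, hp.odd_mul_eq_zero hN hk (a := t) (c := a) fun h => hzb (h ▸ ht.2),
        zero_mul, zero_mul]

theorem odd_commute (hp : IsQuantumEndomorphism (kneserGraph N k) p)
    (hN : N = 2 * k + 1) (hk : 1 ≤ k) (a b c d : {u : Finset (Fin N) // u.card = k}) :
    Commute (p a b) (p c d) := by
  -- Here `j = k - m`, so the induction descends from equal vertices, `m = k`.
  have key : ∀ j m, m + j = k → ∀ a c : {u : Finset (Fin N) // u.card = k},
      (a.1 ∩ c.1).card = m → ∀ b d, Commute (p a b) (p c d) := by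
    intro j
    induction j with
    | zero =>
      intro m hm a c hac b d
      obtain rfl : a = c := by
        by_contra h
        exact card_inter_ne_of_ne h (by omega)
      exact hp.commute_of_eq _ _ _
    | succ j ih =>
      intro m hm a c hac b d
      exact hp.odd_commute_of_card_inter_eq hN hk (by omega) (ih (m + 1) (by omega)) hac b d
  have h := card_sdiff_add_card_inter_eq a c.1
  exact key (a.1 \ c.1).card _ (by omega) a c rfl b d

end OddGraph

end IsQuantumEndomorphism

theorem hasOnlyClassicalEndomorphisms_oddGraph (n : ℕ) :
    HasOnlyClassicalEndomorphisms (oddGraph n) ∧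
      ∀ x y : QuantumEnd (oddGraph n), x * y = y * x := by
  refine hasOnlyClassicalEndomorphisms_of_commute fun a b c d => ?_
  have hp := QuantumEnd.isQuantumEndomorphism_gen (oddGraph n)
  rcases Nat.lt_or_ge 1 n with h | h
  · exact hp.odd_commute (by omega) (by omega) a b c d
  -- Here `n - 1 = 0` and the empty set is the only vertex.
  · obtain rfl : a = c := by
      have h0 : n - 1 = 0 := Nat.sub_eq_zero_of_le h
      exact Subtype.ext ((Finset.card_eq_zero.1 (a.2.trans h0)).trans
        (Finset.card_eq_zero.1 (c.2.trans h0)).symm)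
    exact hp.commute_of_eq _ _ _

theorem mainTheorem9 :
    (∀ n : ℕ,
      HasOnlyClassicalEndomorphisms (SimpleGraph.cycleGraph (2 * n + 1)) ∧
      ∀ x y : QuantumEnd (SimpleGraph.cycleGraph (2 * n + 1)), x * y = y * x) ∧
    (∀ n : ℕ, 1 ≤ n →
      HasOnlyClassicalEndomorphisms (oddGraph n) ∧
      ∀ x y : QuantumEnd (oddGraph n), x * y = y * x) := by
  exact ⟨hasOnlyClassicalEndomorphisms_cycleGraph,
    fun n _ => hasOnlyClassicalEndomorphisms_oddGraph n⟩
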